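/- **Setting.** A (small) site $(\mathcal C,J)$ is a small category with a Grothendieck topology; $\widehat{\mathcal C}=[\mathcal C^{\mathrm{op}},\mathrm{Set}]$, $\widehat{\mathcal C}_J=\mathrm{Sh}(\mathcal C,J)$, and $\mathfrak a_J\dashv \mathfrak i_J$ is the sheafification adjunction. A distributor $H:\mathcal C\looparrowright\mathcal D$ is a functor $\mathcal D^{\mathrm{op}}\times\mathcal C\to\mathrm{Set}$, and a transformation is a natural transformation; $\mathrm{lext}_H:\widehat{\mathcal C}\to\widehat{\mathcal D}$ is $\mathrm{lext}_H(X)(d)=\int^{c}H(d,c)\times X(c)$, with right adjoint $\mathrm{rest}_H(Y)(c)=\widehat{\mathcal D}[H(-,c),Y]$. For $G:\mathcal D\looparrowright\mathcal B$, the tensor product is $(G\otimes H)(b,c)=\int^{d}H(d,c)\times G(b,d)$, and the unit is $\hom_{\mathcal C}$. A distributor $H:\mathcal C\looparrowright\mathcal D$ is a *distributor of sites* $(\mathcal C,J)\looparrowright(\mathcal D,K)$ if 1. (cover-distributing) for all $x\in H(d,c)$ and $S\in J(c)$, the sieve of all $v:d'\to d$ such that $H(v,c)(x)=H(d',u)(x')$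 for some $u:c'\to c$ in $S$ and some $x'\in H(d',c')$ is $K$-covering; and 2. ($K$-flat) (i) for each $d$, the sieve of all $v:d'\to d$ with $H(d',c)\neq\emptyset$ for some $c$ is $K$-covering; (ii) for all $x\in H(d,c)$, $x'\in H(d,c')$, the sieve of all $v:d'\to d$ for which there are $u:c''\to c$, $u':c''\to c'$ and $x''\in H(d',c'')$ with $H(d',u)(x'')=H(v,c)(x)$ and $H(d',u')(x'')=H(v,c')(x')$ is $K$-covering; (iii) for all $u,u':c'\rightrightarrows c$ and $x\in H(d,c')$ with $H(d,u)(x)=H(d,u')(x)$, the sieve of all $v:d'\to d$ for which there are $w:c''\to c'$ with $uw=u'w$ and $x'\in H(d',c'')$ with $H(d',w)(x')=H(v,c')(x)$ is $K$-covering. $\mathrm{Top}$ is the 2-category of Grothendieck topoi, geometric morphisms $f=(f^*\dashv f_*)$ with $f^*$ left exact, and geometric transformations $f\Rightarrow g$, that is, natural transformations $f^*\Rightarrow g^*$. **Theorem.** (a) The units $\hom_{\mathcal C}$ are distributors of sites $(\mathcal C,J)\looparrowright(\mathcal C,J)$ and tensor products of distributors of sites are distributors of sites. Hence small sites, distributors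 of sites and transformations, with composition $\otimes$, units $\hom_{\mathcal C}$ and the canonical associators and unitors, form a bicategory $\mathrm{Site}^{\looparrowright}$. (b) For each distributor of sites $H:(\mathcal C,J)\looparrowright(\mathcal D,K)$, $\mathrm{rest}_H$ sends $K$-sheaves to $J$-sheaves, the functor $\mathrm{Sh}(H)^*:=\mathfrak a_K\,\mathrm{lext}_H\,\mathfrak i_J$ is left exact and left adjoint to $\mathrm{rest}_H:\widehat{\mathcal D}_K\to\widehat{\mathcal C}_J$, so that there is a geometric morphism $\mathrm{Sh}(H):\widehat{\mathcal D}_K\to\widehat{\mathcal C}_J$ with this inverse image; and $\mathfrak a_K\,\mathrm{lext}_H$ factorizes through $\mathfrak a_J$: the canonical transformation $\mathfrak a_K\,\mathrm{lext}_H\Rightarrow\mathrm{Sh}(H)^*\,\mathfrak a_J$ given by the unit of $\mathfrak a_J\dashv\mathfrak i_J$ is invertible. (c) The assignments $(\mathcal C,J)\mapsto\widehat{\mathcal C}_J$, $H\mapsto\mathrm{Sh}(H)$, $\phi\mapsto\mathfrak a_K\,\mathrm{lext}_\phi\,\mathfrak i_J$ underlie a pseudofunctor $$\mathrm{Sh}:(\mathrm{Site}^{\looparrowright})^{\mathrm{op}}\longrightarrow\mathrm{Top}$$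 (where $^{\mathrm{op}}$ reverses 1-cells only) whose structural invertible 2-cells are the canonical ones: on inverse images, $\mathrm{Sh}(G\otimes H)^*\cong\mathrm{Sh}(G)^*\,\mathrm{Sh}(H)^*$ is the composite $\mathfrak a_L\mathrm{lext}_{G\otimes H}\mathfrak i_J\cong\mathfrak a_L\mathrm{lext}_G\mathrm{lext}_H\mathfrak i_J\to\mathfrak a_L\mathrm{lext}_G\mathfrak i_K\mathfrak a_K\mathrm{lext}_H\mathfrak i_J$ given by the unit of $\mathfrak a_K\dashv\mathfrak i_K$, and $\mathrm{Sh}(\hom_{\mathcal C})^*\cong 1$ is the composite $\mathfrak a_J\mathrm{lext}_{\hom_{\mathcal C}}\mathfrak i_J\cong\mathfrak a_J\mathfrak i_J\to 1$ given by the counit of $\mathfrak a_J\dashv\mathfrak i_J$. -/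

import Mathlib

open CategoryTheory Opposite Limits Bicategory

universe u

namespace SiteDistributors

noncomputable section

/-! ### Distributors, their extensions and their tensor product

A distributor `H : C ⇸ D` between small categories is a functor `Dᵒᵖ × C ⥤ Type u`. We use
Mathlib's `Profunctor.{u} C D`, which is the curried form `C ⥤ (Dᵒᵖ ⥤ Type u)`; so
`(H.obj c).obj (op d)` is the set `H(d, c)` of heteromorphisms from `d` to `c`. -/

section Extension

variable {C D B : Type u} [SmallCategory C] [SmallCategory D] [SmallCategory B]

/-- The relation generating the coend `∫^c H(d, c) × X(c)`: for `v : c ⟶ c'`, `x ∈ H(d, c)` and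
`s ∈ X(c')`, the pair `(H(d, v)(x), s)` is identified with `(x, X(v)(s))`. -/
inductive LextRel (H : Profunctor.{u} C D) (X : Cᵒᵖ ⥤ Type u) (d : Dᵒᵖ) :
    (Σ c : C, (H.obj c).obj d × X.obj (op c)) → (Σ c : C, (H.obj c).obj d × X.obj (op c)) → Prop
  | intro {c c' : C} (v : c ⟶ c') (x : (H.obj c).obj d) (s : X.obj (op c')) :
      LextRel H X d ⟨c', (H.map v).app d x, s⟩ ⟨c, x, X.map v.op s⟩

/-- The coend `∫^c H(d, c) × X(c)`. -/
def LextObj (H : Profunctor.{u} C D) (X : Cᵒᵖ ⥤ Type u) (d : Dᵒᵖ) : Type u :=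
  Quot (LextRel H X d)

/-- The class of a pair `(x, s)` in the coend. -/
def LextObj.mk {H : Profunctor.{u} C D} {X : Cᵒᵖ ⥤ Type u} {d : Dᵒᵖ} {c : C}
    (x : (H.obj c).obj d) (s : X.obj (op c)) : LextObj H X d :=
  Quot.mk _ ⟨c, x, s⟩

theorem LextObj.sound {H : Profunctor.{u} C D} {X : Cᵒᵖ ⥤ Type u} {d : Dᵒᵖ} {c c' : C}
    (v : c ⟶ c') (x : (H.obj c).obj d) (s : X.obj (op c')) :
    LextObj.mk (H := H) ((H.map v).app d x) s = LextObj.mk x (X.map v.op s) :=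
  Quot.sound (.intro v x s)

/-- Maps out of the coend. -/
def LextObj.desc {H : Profunctor.{u} C D} {X : Cᵒᵖ ⥤ Type u} {d : Dᵒᵖ} {Z : Type u}
    (f : ∀ c : C, (H.obj c).obj d → X.obj (op c) → Z)
    (hf : ∀ {c c' : C} (v : c ⟶ c') (x : (H.obj c).obj d) (s : X.obj (op c')),
      f c' ((H.map v).app d x) s = f c x (X.map v.op s)) :
    LextObj H X d → Z :=
  Quot.lift (fun p => f p.1 p.2.1 p.2.2) (by rintro _ _ ⟨v, x, s⟩; exact hf v x s)

@[simp]
theorem LextObj.desc_mk {H : Profunctor.{u} C D} {X : Cᵒᵖ ⥤ Type u} {d : Dᵒᵖ} {Z : Type u}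
    (f : ∀ c : C, (H.obj c).obj d → X.obj (op c) → Z) (hf) {c : C}
    (x : (H.obj c).obj d) (s : X.obj (op c)) :
    LextObj.desc (H := H) (X := X) f hf (LextObj.mk x s) = f c x s := rfl

theorem LextObj.ind {H : Profunctor.{u} C D} {X : Cᵒᵖ ⥤ Type u} {d : Dᵒᵖ}
    {P : LextObj H X d → Prop} (h : ∀ (c : C) (x : (H.obj c).obj d) (s : X.obj (op c)),
      P (LextObj.mk x s)) (z : LextObj H X d) : P z := by
  obtain ⟨c, x, s⟩ := z
  exact h c x s

/-- The left extension `lext_H : [Cᵒᵖ, Set] ⥤ [Dᵒᵖ, Set]`,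
`lext_H(X)(d) = ∫^c H(d, c) × X(c)`. -/
def lext (H : Profunctor.{u} C D) : (Cᵒᵖ ⥤ Type u) ⥤ (Dᵒᵖ ⥤ Type u) where
  obj X :=
    { obj := fun d => LextObj H X d
      map := fun {d d'} w => ↾(LextObj.desc
        (fun c x s => LextObj.mk ((H.obj c).map w x) s)
        (fun v x s => by
          rw [← LextObj.sound]
          congr 1
          exact (NatTrans.naturality_apply (H.map v) w x).symm))
      map_id := fun d => by
        ext z; induction z using LextObj.ind with | h c x s => simp
      map_comp := fun f g => by
        ext z; induction z using LextObj.ind with | h c x s => simp }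
  map {X Y} α :=
    { app := fun d => ↾(LextObj.desc
        (fun c x s => LextObj.mk x (α.app (op c) s))
        (fun v x s => by
          rw [LextObj.sound]
          congr 1
          exact (NatTrans.naturality_apply α v.op s).symm))
      naturality := fun d d' w => by
        ext z; induction z using LextObj.ind with | h c x s => simp }
  map_id X := by
    ext d z; induction z using LextObj.ind with | h c x s => rfl
  map_comp α β := by
    ext d z; induction z using LextObj.ind with | h c x s => rfl

@[simp]
theorem lext_obj_map_mk (H : Profunctor.{u} C D) (X : Cᵒᵖ ⥤ Type u) {d d' : Dᵒᵖ} (w : d ⟶ d')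
    {c : C} (x : (H.obj c).obj d) (s : X.obj (op c)) :
    ((lext H).obj X).map w (LextObj.mk x s) = LextObj.mk ((H.obj c).map w x) s := rfl

@[simp]
theorem lext_map_app_mk (H : Profunctor.{u} C D) {X Y : Cᵒᵖ ⥤ Type u} (α : X ⟶ Y) {d : Dᵒᵖ}
    {c : C} (x : (H.obj c).obj d) (s : X.obj (op c)) :
    ((lext H).map α).app d (LextObj.mk x s) = LextObj.mk x (α.app (op c) s) := rfl

theorem lext_hom_ext {H : Profunctor.{u} C D} {F : (Cᵒᵖ ⥤ Type u) ⥤ (Dᵒᵖ ⥤ Type u)}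
    {α β : lext H ⟶ F}
    (h : ∀ (X : Cᵒᵖ ⥤ Type u) (d : Dᵒᵖ) (c : C) (x : (H.obj c).obj d) (s : X.obj (op c)),
      (α.app X).app d (LextObj.mk x s) = (β.app X).app d (LextObj.mk x s)) : α = β := by
  ext X d z; induction z using LextObj.ind with | h c x s => exact h X d c x s

/-- The transformation `lext_H ⟶ lext_H'` induced by a transformation of distributors. -/
def lextMap {H H' : Profunctor.{u} C D} (φ : H ⟶ H') : lext H ⟶ lext H' where
  app X :=
    { app := fun d => ↾(LextObj.desc
        (fun c x s => LextObj.mk ((φ.app c).app d x) s)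
        (fun v x s => by
          rw [← LextObj.sound]
          congr 1
          exact ConcreteCategory.congr_hom (NatTrans.congr_app (φ.naturality v) d) x))
      naturality := fun d d' w => by
        ext z; induction z using LextObj.ind with
        | h c x s => exact congrArg (fun t => LextObj.mk t s)
                      (NatTrans.naturality_apply (φ.app c) w x) }
  naturality X Y α := by
    ext d z; induction z using LextObj.ind with | h c x s => rfl

@[simp]
theorem lextMap_app_app_mk {H H' : Profunctor.{u} C D} (φ : H ⟶ H') (X : Cᵒᵖ ⥤ Type u) {d : Dᵒᵖ}
    {c : C} (x : (H.obj c).obj d) (s : X.obj (op c)) :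
    ((lextMap φ).app X).app d (LextObj.mk x s) = LextObj.mk ((φ.app c).app d x) s := rfl

@[simp]
theorem lextMap_id (H : Profunctor.{u} C D) : lextMap (𝟙 H) = 𝟙 (lext H) :=
  lext_hom_ext fun _ _ _ _ _ => rfl

@[simp]
theorem lextMap_comp {H H' H'' : Profunctor.{u} C D} (φ : H ⟶ H') (ψ : H' ⟶ H'') :
    lextMap (φ ≫ ψ) = lextMap φ ≫ lextMap ψ :=
  lext_hom_ext fun _ _ _ _ _ => rfl

/-- The tensor product `G ⊗ H : C ⇸ B` of `H : C ⇸ D` and `G : D ⇸ B`,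
`(G ⊗ H)(b, c) = ∫^d G(b, d) × H(d, c)`. -/
def tensor (G : Profunctor.{u} D B) (H : Profunctor.{u} C D) : Profunctor.{u} C B :=
  H ⋙ lext G

/-- `lext_{hom_C} ≅ 𝟭`: the class of `(f, s)`, with `f : c' ⟶ c` and `s ∈ X(c)`, is sent to
`X(f)(s)`. -/
def lextId (C : Type u) [SmallCategory C] :
    lext (Profunctor.id : Profunctor.{u} C C) ≅ 𝟭 (Cᵒᵖ ⥤ Type u) where
  hom :=
    { app := fun X =>
        { app := fun d => ↾(LextObj.desc
            (fun c (f : d.unop ⟶ c) s => X.map f.op s)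
            (fun {c c'} v (f : d.unop ⟶ c) s => by
              change X.map (f ≫ v).op s = _
              simp))
          naturality := fun d d' w => by
            ext z; induction z using LextObj.ind with
            | h c f s =>
              change X.map (w.unop ≫ (show d.unop ⟶ c from f)).op s = _
              rw [op_comp, Functor.map_comp]; rfl }
      naturality := fun X Y α => by
        ext d z; induction z using LextObj.ind with
        | h c f s => exact (NatTrans.naturality_apply α (Quiver.Hom.op f) s).symm }
  inv :=
    { app := fun X =>
        { app := fun d => ↾(fun s => LextObj.mk (H := Profunctor.id) (𝟙 d.unop) s)
          naturality := fun d d' w => by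
            ext s
            change LextObj.mk (H := Profunctor.id) (𝟙 d'.unop) (X.map w.unop.op s) =
              LextObj.mk (H := Profunctor.id) (w.unop ≫ 𝟙 d.unop) s
            exact (LextObj.sound (H := Profunctor.id) w.unop (𝟙 d'.unop) s).symm.trans
              (congrArg (fun t => LextObj.mk (H := Profunctor.id) t s)
                (show 𝟙 d'.unop ≫ w.unop = w.unop ≫ 𝟙 d.unop by simp)) }
      naturality := fun X Y α => rfl }
  hom_inv_id := lext_hom_ext fun X d c f s => by
    exact (LextObj.sound (H := Profunctor.id) (show d.unop ⟶ c from f) (𝟙 d.unop) s).symm.trans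
      (congrArg (fun t => LextObj.mk (H := Profunctor.id) t s)
        (show 𝟙 d.unop ≫ (show d.unop ⟶ c from f) = f from Category.id_comp _))
  inv_hom_id := by
    ext X d s
    change X.map (𝟙 d) s = s
    simp

/-- `lext_{G ⊗ H} ≅ lext_G ∘ lext_H`: the class of `((y, x), s)` is sent to the class of
`(y, (x, s))`. -/
def lextComp (H : Profunctor.{u} C D) (G : Profunctor.{u} D B) :
    lext (tensor G H) ≅ lext H ⋙ lext G where
  hom :=
    { app := fun X =>
        { app := fun b => ↾(LextObj.desc
            (fun c z s => LextObj.desc (H := G) (X := H.obj c)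
              (fun d y x => LextObj.mk (H := G) y (LextObj.mk x s))
              (fun v y x => LextObj.sound (X := (lext H).obj X) v y (LextObj.mk x s)) z)
            (fun {c c'} v z s => by
              induction z using LextObj.ind with
              | h d y x => exact congrArg (LextObj.mk (H := G) y) (LextObj.sound v x s)))
          naturality := fun b b' w => by
            ext z; induction z using LextObj.ind with
            | h c z s => induction z using LextObj.ind with | h d y x => rfl }
      naturality := fun X Y α => by
        ext b z; induction z using LextObj.ind with
        | h c z s => induction z using LextObj.ind with | h d y x => rfl }
  inv :=
    { app := fun X =>
        { app := fun b => ↾(LextObj.desc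
            (fun d y z => LextObj.desc (H := H) (X := X)
              (fun c x s => LextObj.mk (H := tensor G H) (LextObj.mk y x) s)
              (fun v x s => LextObj.sound (H := tensor G H) v (LextObj.mk y x) s) z)
            (fun {d d'} v y z => by
              induction z using LextObj.ind with
              | h c x s =>
                exact congrArg (fun t => LextObj.mk (H := tensor G H) t s)
                  (LextObj.sound v y x)))
          naturality := fun b b' w => by
            ext z; induction z using LextObj.ind with
            | h d y z => induction z using LextObj.ind with | h c x s => rfl }
      naturality := fun X Y α => by
        ext b z; induction z using LextObj.ind with
        | h d y z => induction z using LextObj.ind with | h c x s => rfl }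
  hom_inv_id := lext_hom_ext fun X b c z s => by
    induction z using LextObj.ind with | h d y x => rfl
  inv_hom_id := by
    ext X b z
    induction z using LextObj.ind with
    | h d y z => induction z using LextObj.ind with | h c x s => rfl

/-- `lext_H ∘ よ ≅ H`, that is `H ⊗ hom_C ≅ H`: the class of `(x, f)`, with `x ∈ H(d, c')` and
`f : c' ⟶ c`, is sent to `H(d, f)(x)`. -/
def tensorIdIso (H : Profunctor.{u} C D) :
    tensor H (Profunctor.id : Profunctor.{u} C C) ≅ H where
  hom :=
    { app := fun c =>
        { app := fun d => ↾(LextObj.desc (H := H) (X := yoneda.obj c)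
            (fun c' x (f : c' ⟶ c) => (H.map f).app d x)
            (fun {c' c''} v x (f : c'' ⟶ c) => by
              change _ = (H.map (v ≫ f)).app d x
              simp))
          naturality := fun d d' w => by
            ext z; induction z using LextObj.ind with
            | h c' x f => exact NatTrans.naturality_apply (H.map (show c' ⟶ c from f)) w x }
      naturality := fun c₁ c₂ g => by
        ext d z; induction z using LextObj.ind with
        | h c' x f =>
          change (H.map ((show c' ⟶ c₁ from f) ≫ g)).app d x = _
          rw [Functor.map_comp]; rfl }
  inv :=
    { app := fun c =>
        { app := fun d => ↾(fun x => LextObj.mk (H := H) (X := yoneda.obj c) x (𝟙 c))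
          naturality := fun d d' w => rfl }
      naturality := fun c₁ c₂ g => by
        ext d x
        refine (LextObj.sound (H := H) (X := yoneda.obj c₂) g x (𝟙 c₂)).trans
          (congrArg (fun t => LextObj.mk (H := H) (X := yoneda.obj c₂) x t)
            (show g ≫ 𝟙 c₂ = 𝟙 c₁ ≫ g by simp)) }
  hom_inv_id := by
    ext c d z; induction z using LextObj.ind with
    | h c' x f =>
      exact (LextObj.sound (H := H) (X := yoneda.obj c) (show c' ⟶ c from f) x (𝟙 c)).trans
        (congrArg (fun t => LextObj.mk (H := H) (X := yoneda.obj c) x t)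
          (Category.comp_id (show c' ⟶ c from f)))
  inv_hom_id := by
    ext c d x
    change (H.map (𝟙 c)).app d x = x
    simp

/-- The restriction `rest_H`, `rest_H(Y)(c) = Hom(H(-, c), Y)`. -/
def rest (H : Profunctor.{u} C D) : (Dᵒᵖ ⥤ Type u) ⥤ (Cᵒᵖ ⥤ Type u) :=
  yoneda ⋙ (Functor.whiskeringLeft _ _ _).obj (Functor.op H)

/-- An element of `rest_H(Y)(c)` as a morphism of presheaves `H(-, c) ⟶ Y`. -/
def restElt {H : Profunctor.{u} C D} {Y : Dᵒᵖ ⥤ Type u} {c : C}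
    (z : ((rest H).obj Y).obj (op c)) : H.obj c ⟶ Y := z

/-- The adjunction `lext_H ⊣ rest_H`. -/
def lextAdj (H : Profunctor.{u} C D) : lext H ⊣ rest H :=
  Adjunction.mkOfHomEquiv
    { homEquiv := fun X Y =>
        { toFun := fun α =>
            { app := fun c => ↾(fun s =>
                { app := fun d => ↾(fun x => α.app d (LextObj.mk x s))
                  naturality := fun d d' w => by
                    ext x
                    exact NatTrans.naturality_apply α w (LextObj.mk x s) })
              naturality := fun c c' v => by
                ext s
                apply NatTrans.ext
                funext d
                ext x
                exact congrArg (α.app d) (LextObj.sound v.unop x s).symm }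
          invFun := fun β =>
            { app := fun d => ↾(LextObj.desc
                (fun c x s => (restElt (β.app (op c) s)).app d x)
                (fun {c c'} v x s => by
                  have := NatTrans.naturality_apply β v.op s
                  exact (ConcreteCategory.congr_hom (NatTrans.congr_app (congrArg restElt this) d) x).symm))
              naturality := fun d d' w => by
                ext z; induction z using LextObj.ind with
                | h c x s =>
                  exact NatTrans.naturality_apply (restElt (β.app (op c) s)) w x }
          left_inv := fun α => by
            ext d z; induction z using LextObj.ind with | h c x s => rfl
          right_inv := fun β => rfl }
      homEquiv_naturality_left_symm := fun f g => by
        ext d z; induction z using LextObj.ind with | h c x s => rfl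
      homEquiv_naturality_right := fun f g => rfl }

end Extension

/-! ### Sites and distributors of sites -/

/-- A small site: a small category with a Grothendieck topology. -/
structure Site : Type (u + 1) where
  carrier : Type u
  [cat : SmallCategory carrier]
  top : GrothendieckTopology carrier

attribute [instance] Site.cat

section Conditions

variable {C D : Type u} [SmallCategory C] [SmallCategory D] (H : Profunctor.{u} C D)

/-- The sieve `x^*H[S]` on `d`: all `v : d' ⟶ d` such that `H(v, c)(x) = H(d', w)(x')` for some
`w : c' ⟶ c` in `S` and some `x' ∈ H(d', c')`. -/
def pullbackImage {c : C} (S : Sieve c) {d : D} (x : (H.obj c).obj (op d)) : Sieve d where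
  arrows d' v := ∃ (c' : C) (w : c' ⟶ c) (x' : (H.obj c').obj (op d')),
    S w ∧ (H.obj c).map v.op x = (H.map w).app (op d') x'
  downward_closed := by
    rintro d' d'' v ⟨c', w, x', hw, h⟩ t
    refine ⟨c', w, (H.obj c').map t.op x', hw, ?_⟩
    rw [NatTrans.naturality_apply, ← h]
    simp

/-- `H` is cover-distributing from `J` to `K`. -/
def IsCoverDistributing (J : GrothendieckTopology C) (K : GrothendieckTopology D) : Prop :=
  ∀ (c : C) (d : D) (x : (H.obj c).obj (op d)) (S : Sieve c), S ∈ J c →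
    pullbackImage H S x ∈ K d

/-- All `v : d' ⟶ d` such that there is a heteromorphism from `d'` to some `c`. -/
def nonemptySieve (d : D) : Sieve d where
  arrows d' _ := ∃ c : C, Nonempty ((H.obj c).obj (op d'))
  downward_closed := by
    rintro d' d'' v ⟨c, ⟨x⟩⟩ t
    exact ⟨c, ⟨(H.obj c).map t.op x⟩⟩

/-- All `v : d' ⟶ d` such that the restrictions along `v` of `x ∈ H(d, c)` and `x' ∈ H(d, c')`
both factor through one heteromorphism `x'' ∈ H(d', c'')`. -/
def spanSieve {c c' : C} {d : D} (x : (H.obj c).obj (op d)) (x' : (H.obj c').obj (op d)) :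
    Sieve d where
  arrows d' v := ∃ (c'' : C) (w : c'' ⟶ c) (w' : c'' ⟶ c') (x'' : (H.obj c'').obj (op d')),
    (H.map w).app (op d') x'' = (H.obj c).map v.op x ∧
    (H.map w').app (op d') x'' = (H.obj c').map v.op x'
  downward_closed := by
    rintro d' d'' v ⟨c'', w, w', x'', h, h'⟩ t
    refine ⟨c'', w, w', (H.obj c'').map t.op x'', ?_, ?_⟩
    · rw [NatTrans.naturality_apply, h]; simp
    · rw [NatTrans.naturality_apply, h']; simp

/-- All `v : d' ⟶ d` such that the restriction along `v` of `x ∈ H(d, c')` factors through a map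
`t : c'' ⟶ c'` with `t ≫ w = t ≫ w'`. -/
def equalizerSieve {c c' : C} (w w' : c' ⟶ c) {d : D} (x : (H.obj c').obj (op d)) : Sieve d where
  arrows d' v := ∃ (c'' : C) (t : c'' ⟶ c') (x' : (H.obj c'').obj (op d')),
    t ≫ w = t ≫ w' ∧ (H.map t).app (op d') x' = (H.obj c').map v.op x
  downward_closed := by
    rintro d' d'' v ⟨c'', t, x', ht, h⟩ r
    refine ⟨c'', t, (H.obj c'').map r.op x', ht, ?_⟩
    rw [NatTrans.naturality_apply, h]; simp

/-- `H` is `K`-flat. -/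
structure IsCoverFlat (K : GrothendieckTopology D) : Prop where
  nonempty (d : D) : nonemptySieve H d ∈ K d
  span {c c' : C} {d : D} (x : (H.obj c).obj (op d)) (x' : (H.obj c').obj (op d)) :
    spanSieve H x x' ∈ K d
  equalizer {c c' : C} (w w' : c' ⟶ c) {d : D} (x : (H.obj c').obj (op d)) :
    (H.map w).app (op d) x = (H.map w').app (op d) x → equalizerSieve H w w' x ∈ K d

end Conditions

/-- `H` is a distributor of sites `S ⇸ T`. -/
structure IsDistributorOfSites (S T : Site.{u}) (H : Profunctor.{u} S.carrier T.carrier) :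
    Prop where
  coverDistributing : IsCoverDistributing H S.top T.top
  coverFlat : IsCoverFlat H T.top

/-- Distributors of sites from `S` to `T`. -/
structure DistributorOfSites (S T : Site.{u}) : Type (u + 1) where
  dist : Profunctor.{u} S.carrier T.carrier
  isDistributorOfSites : IsDistributorOfSites S T dist

/-- Transformations between distributors of sites: transformations between the underlying
distributors. -/
@[ext]
structure Transformation {S T : Site.{u}} (H H' : DistributorOfSites S T) : Type u where
  trans : H.dist ⟶ H'.dist

instance (S T : Site.{u}) : Category (DistributorOfSites S T) where
  Hom H H' := Transformation H H'
  id H := ⟨𝟙 H.dist⟩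
  comp φ ψ := ⟨φ.trans ≫ ψ.trans⟩

theorem DistributorOfSites.hom_ext {S T : Site.{u}} {H H' : DistributorOfSites S T} {φ ψ : H ⟶ H'}
    (h : ∀ (c : S.carrier) (d : T.carrierᵒᵖ) (x : (H.dist.obj c).obj d),
      (φ.trans.app c).app d x = (ψ.trans.app c).app d x) : φ = ψ := by
  apply Transformation.ext
  ext c d x
  exact h c d x

/-- Invertible transformations from invertible transformations of the underlying distributors. -/
def DistributorOfSites.mkIso {S T : Site.{u}} {H H' : DistributorOfSites S T}
    (e : H.dist ≅ H'.dist) : H ≅ H' where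
  hom := ⟨e.hom⟩
  inv := ⟨e.inv⟩
  hom_inv_id := Transformation.ext e.hom_inv_id
  inv_hom_id := Transformation.ext e.inv_hom_id

theorem DistributorOfSites.eq_conj {S T : Site.{u}} {H H' G G' : DistributorOfSites S T}
    {e : H.dist ≅ G.dist} {e' : H'.dist ≅ G'.dist} {φ : H ⟶ H'} {ψ : G ⟶ G'}
    (h : φ.trans ≫ e'.hom = e.hom ≫ ψ.trans) :
    φ = (mkIso e).hom ≫ ψ ≫ (mkIso e').inv := by
  apply Transformation.ext
  change φ.trans = e.hom ≫ ψ.trans ≫ e'.inv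
  rw [← Category.assoc, ← h, Category.assoc, e'.hom_inv_id, Category.comp_id]

/-- Unit distributors are distributors of sites. -/
def UnitClosed : Prop :=
  ∀ S : Site.{u}, IsDistributorOfSites S S Profunctor.id

/-- Tensor products of distributors of sites are distributors of sites. -/
def TensorClosed : Prop :=
  ∀ (S T U : Site.{u}) (H : Profunctor.{u} S.carrier T.carrier)
    (G : Profunctor.{u} T.carrier U.carrier),
    IsDistributorOfSites S T H → IsDistributorOfSites T U G →
      IsDistributorOfSites S U (tensor G H)

/-- The type of objects of the bicategory of small sites, distributors of sites and
transformations. The two parameters say that its units and composites exist. -/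
@[nolint unusedArguments]
structure SiteDist (hid : UnitClosed.{u}) (hcomp : TensorClosed.{u}) : Type (u + 1) where
  site : Site.{u}

section SiteBicategory

variable {hid : UnitClosed.{u}} {hcomp : TensorClosed.{u}}

instance : CategoryStruct (SiteDist hid hcomp) where
  Hom S T := DistributorOfSites S.site T.site
  id S := ⟨Profunctor.id, hid S.site⟩
  comp {S T U} H G := ⟨tensor G.dist H.dist, hcomp S.site T.site U.site H.dist G.dist
    H.isDistributorOfSites G.isDistributorOfSites⟩

/-- The bicategory of small sites, distributors of sites and transformations. The composite
`H ≫ G` is `G ⊗ H`, the unit is the hom distributor, and the associators and unitors are the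
canonical ones. -/
instance : Bicategory (SiteDist hid hcomp) where
  homCategory S T := inferInstanceAs (Category (DistributorOfSites S.site T.site))
  whiskerLeft H _ _ η := ⟨Functor.whiskerLeft H.dist (lextMap η.trans)⟩
  whiskerRight η G := ⟨Functor.whiskerRight η.trans (lext G.dist)⟩
  associator H G L := DistributorOfSites.mkIso
    (Functor.isoWhiskerLeft H.dist (lextComp G.dist L.dist).symm)
  leftUnitor H := DistributorOfSites.mkIso (tensorIdIso H.dist)
  rightUnitor {_ T} H := DistributorOfSites.mkIso
    (Functor.isoWhiskerLeft H.dist (lextId T.site.carrier) ≪≫ H.dist.rightUnitor)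
  whiskerLeft_id _ _ := DistributorOfSites.hom_ext fun c d z => by
    obtain ⟨e, x, y⟩ := z; rfl
  whiskerLeft_comp _ _ _ _ _ _ := DistributorOfSites.hom_ext fun c d z => by
    obtain ⟨e, x, y⟩ := z; rfl
  id_whiskerLeft η := DistributorOfSites.eq_conj <| by
    ext c d z
    obtain ⟨e, x, y⟩ := z
    exact (ConcreteCategory.congr_hom (NatTrans.congr_app (η.trans.naturality y) d) x).symm
  comp_whiskerLeft _ _ _ _ _ := DistributorOfSites.hom_ext fun c d z => by
    obtain ⟨e, x, ⟨e', x', y⟩⟩ := z; rfl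
  id_whiskerRight _ _ := DistributorOfSites.hom_ext fun c d z => by
    obtain ⟨e, x, y⟩ := z; rfl
  comp_whiskerRight _ _ _ := DistributorOfSites.hom_ext fun c d z => by
    obtain ⟨e, x, y⟩ := z; rfl
  whiskerRight_id η := DistributorOfSites.eq_conj <| by
    ext c d z
    obtain ⟨e, x, y⟩ := z
    exact (NatTrans.naturality_apply (η.trans.app c) (Quiver.Hom.op x) y).symm
  whiskerRight_comp _ _ _ := DistributorOfSites.hom_ext fun c d z => by
    obtain ⟨e, ⟨e', x', x⟩, y⟩ := z; rfl
  whisker_assoc _ _ _ _ _ := DistributorOfSites.hom_ext fun c d z => by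
    obtain ⟨e, x, ⟨e', x', y⟩⟩ := z; rfl
  whisker_exchange _ _ := DistributorOfSites.hom_ext fun c d z => by
    obtain ⟨e, x, y⟩ := z; rfl
  pentagon _ _ _ _ := DistributorOfSites.hom_ext fun c d z => by
    obtain ⟨e, x, ⟨e', x', ⟨e'', x'', y⟩⟩⟩ := z; rfl
  triangle H G := DistributorOfSites.hom_ext fun c d z => by
    obtain ⟨e, x, ⟨e', x', y⟩⟩ := z
    exact LextObj.sound (H := G.dist) (X := H.dist.obj c) x' x y

end SiteBicategory

/-! ### Topoi -/

/-- A Grothendieck topos: a category equivalent to the category of sheaves on a small site. -/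
structure Topos : Type (u + 2) where
  carrier : Type (u + 1)
  [cat : Category.{u} carrier]
  isGrothendieck : ∃ S : Site.{u}, Nonempty (carrier ≌ Sheaf S.top (Type u))

attribute [instance] Topos.cat

/-- A geometric morphism `E ⟶ F`: an adjunction `f^* ⊣ f_*` with `f_* : E ⥤ F` and `f^* : F ⥤ E`
left exact. -/
structure GeometricMorphism (E F : Topos.{u}) : Type (u + 1) where
  inverseImage : F.carrier ⥤ E.carrier
  directImage : E.carrier ⥤ F.carrier
  adj : inverseImage ⊣ directImage
  lex : PreservesFiniteLimits inverseImage

/-- A geometric transformation `f ⟶ g`: a natural transformation `f^* ⟶ g^*`. -/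
@[ext]
structure GeometricTransformation {E F : Topos.{u}} (f g : GeometricMorphism E F) :
    Type (u + 1) where
  trans : f.inverseImage ⟶ g.inverseImage

instance (E F : Topos.{u}) : Category (GeometricMorphism E F) where
  Hom f g := GeometricTransformation f g
  id f := ⟨𝟙 f.inverseImage⟩
  comp φ ψ := ⟨φ.trans ≫ ψ.trans⟩

theorem GeometricMorphism.hom_ext {E F : Topos.{u}} {f g : GeometricMorphism E F} {φ ψ : f ⟶ g}
    (h : ∀ X, φ.trans.app X = ψ.trans.app X) : φ = ψ := by
  apply GeometricTransformation.ext
  ext X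
  exact h X

/-- Invertible geometric transformations from invertible transformations of inverse images. -/
def GeometricMorphism.mkIso {E F : Topos.{u}} {f g : GeometricMorphism E F}
    (e : f.inverseImage ≅ g.inverseImage) : f ≅ g where
  hom := ⟨e.hom⟩
  inv := ⟨e.inv⟩
  hom_inv_id := GeometricTransformation.ext e.hom_inv_id
  inv_hom_id := GeometricTransformation.ext e.inv_hom_id

instance : CategoryStruct Topos.{u} where
  Hom E F := GeometricMorphism E F
  id _ :=
    { inverseImage := 𝟭 _
      directImage := 𝟭 _
      adj := Adjunction.id
      lex := inferInstance }
  comp f g :=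
    { inverseImage := g.inverseImage ⋙ f.inverseImage
      directImage := f.directImage ⋙ g.directImage
      adj := g.adj.comp f.adj
      lex :=
        haveI := f.lex
        haveI := g.lex
        comp_preservesFiniteLimits _ _ }

/-- The 2-category `Top` of Grothendieck topoi, geometric morphisms and geometric
transformations. -/
instance : Bicategory Topos.{u} where
  homCategory E F := inferInstanceAs (Category (GeometricMorphism E F))
  whiskerLeft f _ _ η := ⟨Functor.whiskerRight η.trans f.inverseImage⟩
  whiskerRight η g := ⟨Functor.whiskerLeft g.inverseImage η.trans⟩
  associator f g h := GeometricMorphism.mkIso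
    (Functor.associator h.inverseImage g.inverseImage f.inverseImage).symm
  leftUnitor f := GeometricMorphism.mkIso f.inverseImage.rightUnitor
  rightUnitor f := GeometricMorphism.mkIso f.inverseImage.leftUnitor
  whiskerLeft_id f _ := GeometricMorphism.hom_ext fun _ => f.inverseImage.map_id _
  whiskerLeft_comp f _ _ _ _ _ := GeometricMorphism.hom_ext fun _ => f.inverseImage.map_comp _ _
  id_whiskerLeft η := GeometricMorphism.hom_ext fun X => by
    change η.trans.app X = 𝟙 _ ≫ η.trans.app X ≫ 𝟙 _
    simp
  comp_whiskerLeft f g _ _ η := GeometricMorphism.hom_ext fun X => by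
    change f.inverseImage.map (g.inverseImage.map (η.trans.app X)) =
      𝟙 _ ≫ f.inverseImage.map (g.inverseImage.map (η.trans.app X)) ≫ 𝟙 _
    simp
  id_whiskerRight _ _ := rfl
  comp_whiskerRight _ _ _ := rfl
  whiskerRight_id η := GeometricMorphism.hom_ext fun X => by
    change η.trans.app X = 𝟙 _ ≫ η.trans.app X ≫ 𝟙 _
    simp
  whiskerRight_comp η g h := GeometricMorphism.hom_ext fun X => by
    change η.trans.app (g.inverseImage.obj (h.inverseImage.obj X)) =
      𝟙 _ ≫ η.trans.app (g.inverseImage.obj (h.inverseImage.obj X)) ≫ 𝟙 _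
    simp
  whisker_assoc f _ _ η h := GeometricMorphism.hom_ext fun X => by
    change f.inverseImage.map (η.trans.app (h.inverseImage.obj X)) =
      𝟙 _ ≫ f.inverseImage.map (η.trans.app (h.inverseImage.obj X)) ≫ 𝟙 _
    simp
  whisker_exchange η θ := GeometricMorphism.hom_ext fun X => η.trans.naturality (θ.trans.app X)
  pentagon f g h i := GeometricMorphism.hom_ext fun X => by
    change 𝟙 _ ≫ 𝟙 _ ≫ f.inverseImage.map (𝟙 _) = 𝟙 _ ≫ 𝟙 _
    simp
  triangle f g := GeometricMorphism.hom_ext fun X => by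
    change 𝟙 _ ≫ f.inverseImage.map (𝟙 _) = 𝟙 _
    simp

/-! ### The sheaf topos construction -/

section Sheafification

/-- The topos `Sh(C, J)`. -/
def shTopos (S : Site.{u}) : Topos.{u} where
  carrier := Sheaf S.top (Type u)
  isGrothendieck := ⟨S, ⟨CategoryTheory.Equivalence.refl⟩⟩

variable {S T U : Site.{u}}

/-- The functor `a_K ∘ lext_H ∘ i_J : Sh(C, J) ⥤ Sh(D, K)`. -/
def shInverseImage (H : Profunctor.{u} S.carrier T.carrier) :
    Sheaf S.top (Type u) ⥤ Sheaf T.top (Type u) :=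
  sheafToPresheaf S.top (Type u) ⋙ lext H ⋙ presheafToSheaf T.top (Type u)

/-- The restriction along `H` of a sheaf is a sheaf. -/
def RestPreservesSheaves (S T : Site.{u}) (H : Profunctor.{u} S.carrier T.carrier) : Prop :=
  ∀ Y : T.carrierᵒᵖ ⥤ Type u, Presheaf.IsSheaf T.top Y → Presheaf.IsSheaf S.top ((rest H).obj Y)

/-- The restriction functor `rest_H` between categories of sheaves. -/
def shDirectImage (H : Profunctor.{u} S.carrier T.carrier) (hH : RestPreservesSheaves S T H) :
    Sheaf T.top (Type u) ⥤ Sheaf S.top (Type u) where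
  obj Y := ⟨(rest H).obj Y.obj, hH Y.obj Y.property⟩
  map f := ⟨(rest H).map f.hom⟩

/-- The adjunction `a_K ∘ lext_H ∘ i_J ⊣ rest_H` between categories of sheaves. -/
def shAdj (H : Profunctor.{u} S.carrier T.carrier) (hH : RestPreservesSheaves S T H) :
    shInverseImage H ⊣ shDirectImage H hH :=
  ((lextAdj H).comp (sheafificationAdjunction T.top (Type u))).restrictFullyFaithful
    (iC := sheafToPresheaf S.top (Type u)) (iD := 𝟭 _)
    (fullyFaithfulSheafToPresheaf S.top (Type u)) (Functor.FullyFaithful.id _)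
    (Iso.refl _) (Iso.refl _)

/-- The functors `a_K ∘ lext_H ∘ i_J` of distributors of sites are left exact. -/
def InverseImagesLex : Prop :=
  ∀ (S T : Site.{u}) (H : Profunctor.{u} S.carrier T.carrier), IsDistributorOfSites S T H →
    PreservesFiniteLimits (shInverseImage (S := S) (T := T) H)

/-- The restriction functors of distributors of sites preserve sheaves. -/
def RestrictionsPreserveSheaves : Prop :=
  ∀ (S T : Site.{u}) (H : Profunctor.{u} S.carrier T.carrier), IsDistributorOfSites S T H →
    RestPreservesSheaves S T H

variable (hlex : InverseImagesLex.{u}) (hsh : RestrictionsPreserveSheaves.{u})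

/-- The geometric morphism `Sh(H) : Sh(D, K) ⟶ Sh(C, J)`, with inverse image
`a_K ∘ lext_H ∘ i_J` and direct image `rest_H`. -/
def sh (H : DistributorOfSites S T) : GeometricMorphism (shTopos T) (shTopos S) where
  inverseImage := shInverseImage H.dist
  directImage := shDirectImage H.dist (hsh S T H.dist H.isDistributorOfSites)
  adj := shAdj H.dist (hsh S T H.dist H.isDistributorOfSites)
  lex := hlex S T H.dist H.isDistributorOfSites

/-- The transformation `a_K ∘ lext_φ ∘ i_J`. -/
def shInverseImageMap {H H' : Profunctor.{u} S.carrier T.carrier} (φ : H ⟶ H') :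
    shInverseImage (S := S) (T := T) H ⟶ shInverseImage H' :=
  Functor.whiskerLeft (sheafToPresheaf S.top (Type u))
    (Functor.whiskerRight (lextMap φ) (presheafToSheaf T.top (Type u)))

/-- The canonical transformation
`a_L lext_{G ⊗ H} i_J ≅ a_L lext_G lext_H i_J ⟶ a_L lext_G i_K a_K lext_H i_J`,
where the second map is given by the unit of sheafification. -/
def shInverseImageComp (H : Profunctor.{u} S.carrier T.carrier)
    (G : Profunctor.{u} T.carrier U.carrier) :
    shInverseImage (S := S) (T := U) (tensor G H) ⟶
      shInverseImage (S := S) (T := T) H ⋙ shInverseImage (S := T) (T := U) G :=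
  Functor.whiskerLeft (sheafToPresheaf S.top (Type u))
    (Functor.whiskerRight (lextComp H G).hom (presheafToSheaf U.top (Type u)) ≫
      Functor.whiskerLeft (lext H)
        (Functor.whiskerRight (sheafificationAdjunction T.top (Type u)).unit
          (lext G ⋙ presheafToSheaf U.top (Type u))))

/-- The canonical transformation `a_J lext_{hom} i_J ≅ a_J i_J ⟶ 𝟭`, where the second map is the
counit of sheafification. -/
def shInverseImageId (S : Site.{u}) :
    shInverseImage (S := S) (T := S) Profunctor.id ⟶ 𝟭 (Sheaf S.top (Type u)) :=
  Functor.whiskerLeft (sheafToPresheaf S.top (Type u))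
    (Functor.whiskerRight (lextId S.carrier).hom (presheafToSheaf S.top (Type u))) ≫
  (sheafificationAdjunction S.top (Type u)).counit

/-- The canonical transformation `a_K lext_H ⟶ a_K lext_H i_J a_J` given by the unit of
sheafification. -/
def shFactorization (H : Profunctor.{u} S.carrier T.carrier) :
    lext H ⋙ presheafToSheaf T.top (Type u) ⟶
      presheafToSheaf S.top (Type u) ⋙ shInverseImage (S := S) (T := T) H :=
  Functor.whiskerRight (sheafificationAdjunction S.top (Type u)).unit
    (lext H ⋙ presheafToSheaf T.top (Type u))

end Sheafification

/-- The action of `Sh` on sites, distributors of sites and transformations. -/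
def shPrelax (hid : UnitClosed.{u}) (hcomp : TensorClosed.{u}) (hlex : InverseImagesLex.{u})
    (hsh : RestrictionsPreserveSheaves.{u}) :
    PrelaxFunctor (SiteDist hid hcomp)ᵒᵖ Topos.{u} where
  obj S := shTopos S.unop.site
  map H := sh hlex hsh H.unop
  map₂ φ := ⟨shInverseImageMap φ.unop2.trans⟩
  map₂_id H := GeometricMorphism.hom_ext fun X => by
    change (presheafToSheaf _ (Type u)).map ((lextMap (𝟙 H.unop.dist)).app X.obj) = 𝟙 _
    rw [lextMap_id]
    exact (presheafToSheaf _ (Type u)).map_id _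
  map₂_comp φ ψ := GeometricMorphism.hom_ext fun X => by
    change (presheafToSheaf _ (Type u)).map
      ((lextMap (φ.unop2.trans ≫ ψ.unop2.trans)).app X.obj) = _
    rw [lextMap_comp]
    exact (presheafToSheaf _ (Type u)).map_comp _ _

section Comparison

variable {hid : UnitClosed.{u}} {hcomp : TensorClosed.{u}} (hlex : InverseImagesLex.{u})
  (hsh : RestrictionsPreserveSheaves.{u})

/-- The canonical 2-cell `Sh(hom_C) ⟶ 𝟙`. -/
def shUnitCell (S : (SiteDist hid hcomp)ᵒᵖ) :
    (shPrelax hid hcomp hlex hsh).map (𝟙 S) ⟶ 𝟙 ((shPrelax hid hcomp hlex hsh).obj S) :=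
  GeometricTransformation.mk (shInverseImageId S.unop.site)

/-- The canonical 2-cell `Sh(G ⊗ H) ⟶ Sh(G) ≫ Sh(H)`, where `G` and `H` are composable in the
opposite bicategory. -/
def shTensorCell {U T S : (SiteDist hid hcomp)ᵒᵖ} (G : U ⟶ T) (H : T ⟶ S) :
    (shPrelax hid hcomp hlex hsh).map (G ≫ H) ⟶
      (shPrelax hid hcomp hlex hsh).map G ≫ (shPrelax hid hcomp hlex hsh).map H :=
  GeometricTransformation.mk (shInverseImageComp H.unop.dist G.unop.dist)

end Comparison

end

end SiteDistributors

/-!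
Everything rests on a description of equality in the coend `lext_H(X)(d) = ∫^c H(d, c) × X(c)` for a
`K`-flat distributor `H`: two pairs `(x, s)` and `(x', s')` have the same class if and only if,
after restriction along a `K`-covering sieve, they are identified by a single span `c ⟵ c₀ ⟶ c'`
(`IsCoverFlat.agreementSieve_mem`). Flatness says that the categories of elements of `H(d, -)` are
cofiltered `K`-locally in `d`, so the usual description of equality in a filtered colimit holds
`K`-locally.

* Closure under `⊗`: a covering condition for `G ⊗ H` at a class `[y, x]` is a covering condition
  for `H` at `x`, transported along `y` because `G` is cover-distributing. The coend description
  is needed once, for the equalizer condition (`IsCoverFlat.tensor`).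
* Left exactness: the comparison maps of `lext_H` for the terminal object and for pullbacks are
  `K`-locally bijective, so they are inverted by the left exact functor `a_K`
  (`IsCoverFlat.preservesTerminal`, `IsCoverFlat.preservesPullbacks`).
* Restriction of sheaves: for a `J`-covering sieve `S` on `c`, the map `lext_H(S) ⟶ lext_H(よ c)` is
  `K`-locally surjective because `H` is cover-distributing, and `K`-locally injective because `H` is
  flat. Through `lext_H ⊣ rest_H`, this says that `rest_H` of a `K`-sheaf is a `J`-sheaf
  (`isSheaf_rest`). Hence `lext_H` sends morphisms inverted by `a_J` to morphisms inverted by `a_K`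
  (`W_lext_map`); applied to the unit of sheafification, this gives the factorization of
  `a_K lext_H` through `a_J`, as well as the invertibility of the comparison cells of `Sh`.
* Pseudofunctoriality: each coherence law is the image under sheafification of an equation between
  presheaf maps out of a coend, where it is checked on representatives and reduces to naturality of
  the unit of sheafification and to the triangle identities.
-/

namespace SiteDistributors

/-! ### Equality in the coend of a flat distributor -/

section LocalEquality

variable {C D : Type u} [SmallCategory C] [SmallCategory D]

theorem profunctor_map_map (H : Profunctor.{u} C D) {c c' : C} {d d' : D} (w : c ⟶ c')
    (v : d' ⟶ d) (x : (H.obj c).obj (op d)) :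
    (H.obj c').map v.op ((H.map w).app (op d) x) =
      (H.map w).app (op d') ((H.obj c).map v.op x) :=
  (NatTrans.naturality_apply (H.map w) v.op x).symm

theorem profunctor_map_comp (H : Profunctor.{u} C D) {c c' c'' : C} {d : D} (w : c ⟶ c')
    (w' : c' ⟶ c'') (x : (H.obj c).obj (op d)) :
    (H.map (w ≫ w')).app (op d) x = (H.map w').app (op d) ((H.map w).app (op d) x) := by
  simp

theorem presheaf_map_comp (X : Dᵒᵖ ⥤ Type u) {d d' d'' : D} (v : d' ⟶ d) (v' : d'' ⟶ d')
    (s : X.obj (op d)) : X.map (v' ≫ v).op s = X.map v'.op (X.map v.op s) := by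
  simp

/-- The pairs `(x, s)` and `(x', s')` in `∐ c, H(d, c) × X(c)` are identified by a single span when
restricted along `v : d' ⟶ d`: there are `x₀ ∈ H(d', c₀)` and `t : c₀ ⟶ c`, `t' : c₀ ⟶ c'` with
`t x₀ = x v`, `t' x₀ = x' v` and `s t = s' t'`. -/
def agreementSieve (H : Profunctor.{u} C D) (X : Cᵒᵖ ⥤ Type u) {d : D}
    (p p' : Σ c : C, (H.obj c).obj (op d) × X.obj (op c)) : Sieve d where
  arrows d' v := ∃ (c₀ : C) (t : c₀ ⟶ p.1) (t' : c₀ ⟶ p'.1) (x₀ : (H.obj c₀).obj (op d')),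
    (H.map t).app (op d') x₀ = (H.obj p.1).map v.op p.2.1 ∧
    (H.map t').app (op d') x₀ = (H.obj p'.1).map v.op p'.2.1 ∧
    X.map t.op p.2.2 = X.map t'.op p'.2.2
  downward_closed := by
    rintro d' d'' v ⟨c₀, t, t', x₀, h, h', hs⟩ r
    refine ⟨c₀, t, t', (H.obj c₀).map r.op x₀, ?_, ?_, hs⟩
    · rw [← profunctor_map_map, h, presheaf_map_comp]
    · rw [← profunctor_map_map, h', presheaf_map_comp]

/-- If `H` is `K`-flat, two pairs with the same class in `lext_H(X)(d)` are `K`-locally identified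
by a single span. Reflexivity and symmetry are clear, and two consecutive spans can be `K`-locally
composed: the apices are dominated by a third one, and the two resulting maps
to the middle object are equalized after a further refinement. -/
theorem IsCoverFlat.agreementSieve_mem {H : Profunctor.{u} C D} {K : GrothendieckTopology D}
    (hH : IsCoverFlat H K) {X : Cᵒᵖ ⥤ Type u} {d : D} {c c' : C}
    {x : (H.obj c).obj (op d)} {s : X.obj (op c)} {x' : (H.obj c').obj (op d)} {s' : X.obj (op c')}
    (h : LextObj.mk x s = LextObj.mk x' s') :
    agreementSieve H X ⟨c, x, s⟩ ⟨c', x', s'⟩ ∈ K d := by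
  have h := Quot.eqvGen_exact h
  generalize (⟨c, x, s⟩ : Σ c : C, (H.obj c).obj (op d) × X.obj (op c)) = p at h ⊢
  generalize (⟨c', x', s'⟩ : Σ c : C, (H.obj c).obj (op d) × X.obj (op c)) = p' at h ⊢
  induction h with
  | rel _ _ h =>
    obtain ⟨v, x, s⟩ := h
    refine K.superset_covering ?_ (K.top_mem d)
    intro d' w _
    exact ⟨_, v, 𝟙 _, (H.obj _).map w.op x, (profunctor_map_map H v w x).symm, by simp, by simp⟩
  | refl p =>
    refine K.superset_covering ?_ (K.top_mem d)
    intro d' w _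
    exact ⟨_, 𝟙 _, 𝟙 _, (H.obj _).map w.op p.2.1, by simp, by simp, rfl⟩
  | symm p p' _ ih =>
    refine K.superset_covering ?_ ih
    rintro d' w ⟨c₀, t, t', x₀, h, h', hs⟩
    exact ⟨c₀, t', t, x₀, h', h, hs.symm⟩
  | trans p q r _ _ ih ih' =>
    refine K.transitive (K.intersection_covering ih ih') _ ?_
    rintro d₁ v ⟨⟨c₀, t, t', x₀, h₁, h₁', hs⟩, ⟨c₁, r, r', x₁, h₂, h₂', hs'⟩⟩
    refine K.transitive (hH.span x₀ x₁) _ ?_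
    rintro d₂ v₂ ⟨c₂, w, w', x₂, e, e'⟩
    -- `w ≫ t'` and `w' ≫ r` agree on `x₂`: both send it to the restriction of the middle
    -- heteromorphism.
    have key : (H.map (w ≫ t')).app (op d₂) x₂ = (H.map (w' ≫ r)).app (op d₂) x₂ := by
      rw [profunctor_map_comp, profunctor_map_comp, e, e', ← profunctor_map_map,
        ← profunctor_map_map, h₁', h₂]
    refine K.superset_covering ?_ (hH.equalizer _ _ x₂ key)
    rintro d₃ v₃ ⟨c₃, z, x₃, hz, e₃⟩
    refine ⟨c₃, z ≫ w ≫ t, z ≫ w' ≫ r', x₃, ?_, ?_, ?_⟩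
    · rw [profunctor_map_comp, profunctor_map_comp, e₃, ← profunctor_map_map, e,
        ← profunctor_map_map, ← profunctor_map_map, h₁]
      simp
    · rw [profunctor_map_comp, profunctor_map_comp, e₃, ← profunctor_map_map, e',
        ← profunctor_map_map, ← profunctor_map_map, h₂']
      simp
    · rw [presheaf_map_comp, presheaf_map_comp, hs, ← presheaf_map_comp, ← presheaf_map_comp,
        Category.assoc, hz, presheaf_map_comp, presheaf_map_comp, hs', ← presheaf_map_comp,
        ← presheaf_map_comp, Category.assoc]

end LocalEquality

/-! ### Units and tensor products of distributors of sites -/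

section Closure

theorem unitClosed : UnitClosed.{u} := fun S =>
  { coverDistributing := fun c d (x : d ⟶ c) R hR => by
      refine S.top.superset_covering ?_ (S.top.pullback_stable x hR)
      intro d' v hv
      exact ⟨d', v ≫ x, 𝟙 d', hv, (Category.id_comp (v ≫ x)).symm⟩
    coverFlat :=
      { nonempty := fun d => by
          refine S.top.superset_covering ?_ (S.top.top_mem d)
          intro d' v _
          exact ⟨d', ⟨𝟙 d'⟩⟩
        span := fun {c c' d} (x : d ⟶ c) (x' : d ⟶ c') => by
          refine S.top.superset_covering ?_ (S.top.top_mem d)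
          intro d' v _
          exact ⟨d', v ≫ x, v ≫ x', 𝟙 d', Category.id_comp (v ≫ x), Category.id_comp (v ≫ x')⟩
        equalizer := fun {c c'} w w' {d} (x : d ⟶ c') (h : x ≫ w = x ≫ w') => by
          refine S.top.superset_covering ?_ (S.top.top_mem d)
          intro d' v _
          refine ⟨d', v ≫ x, 𝟙 d', ?_, Category.id_comp (v ≫ x)⟩
          rw [Category.assoc, Category.assoc, h] } }

variable {C D B : Type u} [SmallCategory C] [SmallCategory D] [SmallCategory B]
  {G : Profunctor.{u} D B} {H : Profunctor.{u} C D} {J : GrothendieckTopology C}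
  {K : GrothendieckTopology D} {L : GrothendieckTopology B}

theorem IsCoverDistributing.tensor (hH : IsCoverDistributing H J K)
    (hG : IsCoverDistributing G K L) : IsCoverDistributing (tensor G H) J L := by
  intro c b z S hS
  induction z using LextObj.ind with
  | h d y x =>
    refine L.superset_covering ?_ (hG d b y _ (hH c d x S hS))
    rintro b' v ⟨d', w, y', ⟨c', w', x', hw', e'⟩, e⟩
    refine ⟨c', w', LextObj.mk (H := G) (X := H.obj c') y' x', hw', ?_⟩
    calc LextObj.mk (H := G) (X := H.obj c) ((G.obj d).map v.op y) x
        = LextObj.mk (H := G) (X := H.obj c) ((G.map w).app (op b') y') x := by rw [e]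
      _ = LextObj.mk (H := G) (X := H.obj c) y' ((H.obj c).map w.op x) := LextObj.sound _ _ _
      _ = LextObj.mk (H := G) (X := H.obj c) y' ((H.map w').app (op d') x') := by rw [e']

/-- The conditions for `G ⊗ H` at a class `[y, x]` hold on the `K`-covering sieves given by flatness
of `H` at `x`; cover-distributivity of `G` transports these sieves along `y` to `L`-covering
sieves. For the equalizer condition, the given equation lives in a coend, and must first be made
into an equation in `H` by `IsCoverFlat.agreementSieve_mem`. -/
theorem IsCoverFlat.tensor (hH : IsCoverFlat H K) (hG : IsCoverDistributing G K L)
    (hG' : IsCoverFlat G L) : IsCoverFlat (tensor G H) L where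
  nonempty b := by
    refine L.transitive (hG'.nonempty b) _ ?_
    rintro b₁ v ⟨d, ⟨y⟩⟩
    refine L.superset_covering ?_ (hG d b₁ y _ (hH.nonempty d))
    rintro b₂ v₂ ⟨d', w, y', ⟨c, ⟨x⟩⟩, -⟩
    exact ⟨c, ⟨LextObj.mk (H := G) (X := H.obj c) y' x⟩⟩
  span {c c' b} z z' := by
    induction z using LextObj.ind with
    | h d y x =>
    induction z' using LextObj.ind with
    | h d' y' x' =>
      refine L.transitive (hG'.span y y') _ ?_
      rintro b₁ v₁ ⟨e, w, w', y₁, h, h'⟩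
      refine L.superset_covering ?_
        (hG e b₁ y₁ _ (hH.span ((H.obj c).map w.op x) ((H.obj c').map w'.op x')))
      rintro b₂ v₂ ⟨e₂, r, y₂, ⟨c₂, t, t', x₂, hx, hx'⟩, hy⟩
      -- Both restrictions of `z` and `z'` are represented by pairs with first component `y₂`.
      have aux {c₀ : C} {d₀ : D} (y₀ : (G.obj d₀).obj (op b)) (x₀ : (H.obj c₀).obj (op d₀))
          (w₀ : e ⟶ d₀) (h₀ : (G.map w₀).app (op b₁) y₁ = (G.obj d₀).map v₁.op y₀)
          (t₀ : c₂ ⟶ c₀) (hx₀ : (H.map t₀).app (op e₂) x₂ =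
            (H.obj c₀).map r.op ((H.obj c₀).map w₀.op x₀)) :
          LextObj.mk (H := G) (X := H.obj c₀) y₂ ((H.map t₀).app (op e₂) x₂) =
            LextObj.mk (H := G) (X := H.obj c₀) ((G.obj d₀).map (v₂ ≫ v₁).op y₀) x₀ := by
        rw [presheaf_map_comp, ← h₀, profunctor_map_map, hy, hx₀, LextObj.sound, LextObj.sound]
      exact ⟨c₂, t, t', LextObj.mk (H := G) (X := H.obj c₂) y₂ x₂,
        aux y x w h t hx, aux y' x' w' h' t' hx'⟩
  equalizer {c c'} w w' {b} z hz := by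
    induction z using LextObj.ind with
    | h d y x =>
      refine L.transitive (hG'.agreementSieve_mem (X := H.obj c) hz) _ ?_
      rintro b₁ v₁ ⟨d₁, t, t', y₁, (h : (G.map t).app _ y₁ = (G.obj d).map v₁.op y),
        (h' : (G.map t').app _ y₁ = (G.obj d).map v₁.op y),
        (hx : (H.obj c).map t.op ((H.map w).app _ x) = (H.obj c).map t'.op ((H.map w').app _ x))⟩
      -- The two legs of the span have the same value on `y₁`, hence they may be assumed equal.
      refine L.transitive (hG'.equalizer t t' y₁ (h.trans h'.symm)) _ ?_
      rintro b₂ v₂ ⟨d₂, r, y₂, hr, e₂⟩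
      have hx' : (H.map w).app _ ((H.obj c').map (r ≫ t).op x) =
          (H.map w').app _ ((H.obj c').map (r ≫ t).op x) := by
        rw [← profunctor_map_map, presheaf_map_comp, hx, ← presheaf_map_comp, ← hr,
          profunctor_map_map]
      refine L.superset_covering ?_ (hG d₂ b₂ y₂ _ (hH.equalizer w w' _ hx'))
      rintro b₃ v₃ ⟨d₃, q, y₃, ⟨c₃, p, x₃, hp, hx₃⟩, hy₃⟩
      refine ⟨c₃, p, LextObj.mk (H := G) (X := H.obj c₃) y₃ x₃, hp, ?_⟩
      change LextObj.mk (H := G) (X := H.obj c') y₃ ((H.map p).app (op d₃) x₃) =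
        LextObj.mk (H := G) (X := H.obj c') ((G.obj d).map ((v₃ ≫ v₂) ≫ v₁).op y) x
      rw [hx₃, presheaf_map_comp (G.obj d), ← h, profunctor_map_map,
        presheaf_map_comp (G.obj d₁), ← e₂,
        profunctor_map_map, hy₃, LextObj.sound, LextObj.sound, LextObj.sound,
        presheaf_map_comp (H.obj c')]

theorem tensorClosed : TensorClosed.{u} := fun _ _ _ _ _ hH hG =>
  { coverDistributing := hH.coverDistributing.tensor hG.coverDistributing
    coverFlat := hH.coverFlat.tensor hG.coverDistributing hG.coverFlat }

end Closure

/-! ### Left exactness of the inverse image -/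

section Exactness

variable {C D : Type u} [SmallCategory C] [SmallCategory D]
  {H : Profunctor.{u} C D} {K : GrothendieckTopology D}

theorem exists_of_isPullback {P X Y Z : Cᵒᵖ ⥤ Type u} {fst : P ⟶ X} {snd : P ⟶ Y} {f : X ⟶ Z}
    {g : Y ⟶ Z} (h : IsPullback fst snd f g) {c : Cᵒᵖ} (s : X.obj c) (t : Y.obj c)
    (hst : f.app c s = g.app c t) : ∃ p : P.obj c, fst.app c p = s ∧ snd.app c p = t :=
  ((Types.isPullback_iff _ _ _ _).1 (h.map ((evaluation _ _).obj c))).2.2 s t hst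

theorem ext_of_isPullback {P X Y Z : Cᵒᵖ ⥤ Type u} {fst : P ⟶ X} {snd : P ⟶ Y} {f : X ⟶ Z}
    {g : Y ⟶ Z} (h : IsPullback fst snd f g) {c : Cᵒᵖ} (p q : P.obj c)
    (h₁ : fst.app c p = fst.app c q) (h₂ : snd.app c p = snd.app c q) : p = q :=
  ((Types.isPullback_iff _ _ _ _).1 (h.map ((evaluation _ _).obj c))).2.1 p q ⟨h₁, h₂⟩

/-- A representative of an element of `lext_H(X)` can be moved along a common factorization. -/
theorem LextObj.map_mk_eq {X : Cᵒᵖ ⥤ Type u} {c c₀ : C} {d d' : D} (v : d' ⟶ d) (t : c₀ ⟶ c)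
    (x : (H.obj c).obj (op d)) (x₀ : (H.obj c₀).obj (op d'))
    (h : (H.map t).app (op d') x₀ = (H.obj c).map v.op x) (s : X.obj (op c)) :
    ((lext H).obj X).map v.op (LextObj.mk x s) = LextObj.mk x₀ (X.map t.op s) := by
  rw [lext_obj_map_mk, ← h, LextObj.sound]

/-- The comparison map `m` from `lext_H` of a pullback to a pullback of `lext_H`'s is `K`-locally
injective. Two elements with equal components are locally identified by one span in each
component; the apices of both spans are dominated by a third one, on which the two left legs and
then the two right legs are equalized, so that a single span remains.

Only the equations for the projections of `Q` are used, so `Q` need not be a pullback. -/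
theorem IsCoverFlat.isLocallyInjective_pullbackLift (hH : IsCoverFlat H K)
    {P X Y Z : Cᵒᵖ ⥤ Type u} {fst : P ⟶ X} {snd : P ⟶ Y} {f : X ⟶ Z}
    {g : Y ⟶ Z} (h : IsPullback fst snd f g) {Q : Dᵒᵖ ⥤ Type u} {fst' : Q ⟶ (lext H).obj X}
    {snd' : Q ⟶ (lext H).obj Y} (m : (lext H).obj P ⟶ Q) (hm : m ≫ fst' = (lext H).map fst)
    (hm' : m ≫ snd' = (lext H).map snd) :
    Presheaf.IsLocallyInjective K m where
  equalizerSieve_mem {d} z z' hz := by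
    have e₁ := congrArg (fst'.app d) hz
    have e₂ := congrArg (snd'.app d) hz
    simp only [← NatTrans.comp_app_apply, hm, hm'] at e₁ e₂
    induction z using LextObj.ind with
    | h c x p =>
    induction z' using LextObj.ind with
    | h c' x' p' =>
      refine K.transitive (K.intersection_covering
        (hH.agreementSieve_mem e₁) (hH.agreementSieve_mem e₂)) _ ?_
      rintro d₁ v ⟨⟨c₀, t, t', x₀, h₁, h₁', hs⟩, ⟨c₁, r, r', x₁, h₂, h₂', hs'⟩⟩
      dsimp only at t t' r r' h₁ h₁' h₂ h₂' hs hs'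
      refine K.transitive (hH.span x₀ x₁) _ ?_
      rintro d₂ v₂ ⟨c₂, w, w', x₂, e, e'⟩
      have key {b : C} (a : c₀ ⟶ b) (a' : c₁ ⟶ b) (y : (H.obj b).obj d)
          (h : (H.map a).app _ x₀ = (H.obj b).map v.op y)
          (h' : (H.map a').app _ x₁ = (H.obj b).map v.op y) :
          (H.map (w ≫ a)).app (op d₂) x₂ = (H.map (w' ≫ a')).app (op d₂) x₂ := by
        rw [profunctor_map_comp, profunctor_map_comp, e, e', ← profunctor_map_map,
          ← profunctor_map_map, h, h']
      refine K.transitive (hH.equalizer _ _ x₂ (key t r x h₁ h₂)) _ ?_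
      rintro d₃ v₃ ⟨c₃, z, x₃, hz, e₃⟩
      have key' : (H.map (z ≫ w ≫ t')).app (op d₃) x₃ = (H.map (z ≫ w' ≫ r')).app (op d₃) x₃ := by
        rw [profunctor_map_comp, profunctor_map_comp _ z, e₃, ← profunctor_map_map,
          key t' r' x' h₁' h₂', profunctor_map_map]
      refine K.superset_covering ?_ (hH.equalizer _ _ x₃ key')
      rintro d₄ v₄ ⟨c₄, q, x₄, hq, e₄⟩
      have fac {b : C} (a : c₀ ⟶ b) (y : (H.obj b).obj d)
          (h : (H.map a).app _ x₀ = (H.obj b).map v.op y) :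
          (H.map (q ≫ z ≫ w ≫ a)).app (op d₄) x₄ =
            (H.obj b).map (v₄ ≫ v₃ ≫ v₂ ≫ v).op y := by
        rw [profunctor_map_comp, e₄, ← profunctor_map_map, profunctor_map_comp, e₃,
          ← profunctor_map_map, profunctor_map_comp, e, ← profunctor_map_map, h]
        simp
      change ((lext H).obj P).map (((v₄ ≫ v₃) ≫ v₂) ≫ v).op _ =
        ((lext H).obj P).map (((v₄ ≫ v₃) ≫ v₂) ≫ v).op _
      simp only [Category.assoc]
      rw [LextObj.map_mk_eq _ _ _ _ (fac t x h₁), LextObj.map_mk_eq _ _ _ _ (fac t' x' h₁')]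
      congr 1
      refine ext_of_isPullback h _ _ ?_ ?_
      · rw [NatTrans.naturality_apply, NatTrans.naturality_apply]
        simp only [presheaf_map_comp, hs]
      · rw [NatTrans.naturality_apply, NatTrans.naturality_apply, hz, hq]
        simp only [presheaf_map_comp, hs']

/-- A pair of classes `[x, s]`, `[x', s']` with the same image in `lext_H(Z)` is locally of the
form `[x₀, s t]`, `[x₀, s' t']` where `s t` and `s' t'` have the same image in `Z`. -/
theorem IsCoverFlat.isLocallySurjective_pullbackLift (hH : IsCoverFlat H K)
    {P X Y Z : Cᵒᵖ ⥤ Type u} {fst : P ⟶ X} {snd : P ⟶ Y} {f : X ⟶ Z}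
    {g : Y ⟶ Z} (h : IsPullback fst snd f g) {Q : Dᵒᵖ ⥤ Type u} {fst' : Q ⟶ (lext H).obj X}
    {snd' : Q ⟶ (lext H).obj Y} (h' : IsPullback fst' snd' ((lext H).map f) ((lext H).map g))
    (m : (lext H).obj P ⟶ Q) (hm : m ≫ fst' = (lext H).map fst)
    (hm' : m ≫ snd' = (lext H).map snd) :
    Presheaf.IsLocallySurjective K m where
  imageSieve_mem {d} q := by
    have e := ConcreteCategory.congr_hom (NatTrans.congr_app h'.w (op d)) q
    obtain ⟨z, hz⟩ : ∃ z, z = fst'.app (op d) q := ⟨_, rfl⟩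
    obtain ⟨z', hz'⟩ : ∃ z', z' = snd'.app (op d) q := ⟨_, rfl⟩
    simp only [NatTrans.comp_app_apply, ← hz, ← hz'] at e
    induction z using LextObj.ind with
    | h c x s =>
    induction z' using LextObj.ind with
    | h c' x' s' =>
      refine K.superset_covering ?_ (hH.agreementSieve_mem e)
      rintro d₁ v ⟨c₀, t, t', x₀, h₁, h₁', hs⟩
      dsimp only at t t' h₁ h₁' hs
      rw [← NatTrans.naturality_apply, ← NatTrans.naturality_apply] at hs
      obtain ⟨p, hp, hp'⟩ := exists_of_isPullback h _ _ hs
      refine ⟨LextObj.mk x₀ p, ext_of_isPullback h' _ _ ?_ ?_⟩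
      · change (m ≫ fst').app _ (LextObj.mk x₀ p) = _
        rw [hm, NatTrans.naturality_apply, ← hz,
          LextObj.map_mk_eq _ _ _ _ h₁, lext_map_app_mk, hp]
      · change (m ≫ snd').app _ (LextObj.mk x₀ p) = _
        rw [hm', NatTrans.naturality_apply, ← hz',
          LextObj.map_mk_eq _ _ _ _ h₁', lext_map_app_mk, hp']

theorem nonempty_unique_of_isTerminal {X : Cᵒᵖ ⥤ Type u} (hX : IsTerminal X) (c : Cᵒᵖ) :
    Nonempty (Unique (X.obj c)) :=
  ⟨Types.isTerminalEquivUnique _ (hX.isTerminalObj ((evaluation _ _).obj c) _)⟩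

theorem IsCoverFlat.preservesTerminal (hH : IsCoverFlat H K) :
    PreservesLimit (Functor.empty.{0} _) (lext H ⋙ presheafToSheaf K (Type u)) := by
  let m := terminal.from ((lext H).obj (⊤_ _))
  have : Presheaf.IsLocallyInjective K m :=
    { equalizerSieve_mem := fun {d} z z' _ => by
        induction z using LextObj.ind with
        | h c x s =>
        induction z' using LextObj.ind with
        | h c' x' s' =>
          refine K.superset_covering ?_ (hH.span x x')
          rintro d₁ v ⟨c₀, t, t', x₀, h, h'⟩
          change ((lext H).obj _).map v.op _ = ((lext H).obj _).map v.op _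
          rw [LextObj.map_mk_eq _ _ _ _ h, LextObj.map_mk_eq _ _ _ _ h']
          obtain ⟨_⟩ := nonempty_unique_of_isTerminal terminalIsTerminal (op c₀)
          exact congrArg (LextObj.mk x₀) (Subsingleton.elim _ _) }
  have : Presheaf.IsLocallySurjective K m :=
    { imageSieve_mem := fun {d} q => by
        refine K.superset_covering ?_ (hH.nonempty d)
        rintro d₁ v ⟨c, ⟨x⟩⟩
        obtain ⟨_⟩ := nonempty_unique_of_isTerminal terminalIsTerminal (op c)
        obtain ⟨_⟩ :=
          nonempty_unique_of_isTerminal (terminalIsTerminal (C := Dᵒᵖ ⥤ Type u)) (op d₁)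
        exact ⟨LextObj.mk x default, Subsingleton.elim _ _⟩ }
  have : IsIso ((presheafToSheaf K (Type u)).map m) :=
    (K.W_iff m).1 (K.W_of_isLocallyBijective m)
  exact preservesTerminal_of_iso _ (asIso ((presheafToSheaf K (Type u)).map m) ≪≫
    (terminalIsTerminal.isTerminalObj (presheafToSheaf K (Type u)) _).uniqueUpToIso
      terminalIsTerminal)

theorem IsCoverFlat.preservesPullbacks (hH : IsCoverFlat H K) :
    PreservesLimitsOfShape WalkingCospan (lext H ⋙ presheafToSheaf K (Type u)) := by
  refine preservesLimitsOfShape_walkingCospan_of_forall_isPullback fun X Y Z f g _ =>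
    ⟨_, _, _, IsPullback.of_hasPullback f g, ?_⟩
  have hP := IsPullback.of_hasPullback f g
  have hQ := IsPullback.of_hasPullback ((lext H).map f) ((lext H).map g)
  obtain ⟨m, hm, hm'⟩ := hQ.exists_lift ((lext H).map (pullback.fst f g))
    ((lext H).map (pullback.snd f g)) (by rw [← Functor.map_comp, hP.w, Functor.map_comp])
  have := hH.isLocallyInjective_pullbackLift hP m hm hm'
  have := hH.isLocallySurjective_pullbackLift hP hQ m hm hm'
  have : IsIso ((presheafToSheaf K (Type u)).map m) :=
    (K.W_iff m).1 (K.W_of_isLocallyBijective m)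
  refine (hQ.map (presheafToSheaf K (Type u))).of_iso
    (asIso ((presheafToSheaf K (Type u)).map m)).symm (Iso.refl _) (Iso.refl _) (Iso.refl _)
    ?_ ?_ ?_ ?_
  · simp [← Functor.map_comp, hm]
  · simp [← Functor.map_comp, hm']
  · simp
  · simp

end Exactness

theorem inverseImagesLex : InverseImagesLex.{u} := fun S T H hH => by
  have := hH.coverFlat.preservesPullbacks
  have := hH.coverFlat.preservesTerminal
  have := preservesLimitsOfShape_pempty_of_preservesTerminal
    (lext H ⋙ presheafToSheaf T.top (Type u))
  have := preservesFiniteLimits_of_preservesTerminal_and_pullbacks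
    (lext H ⋙ presheafToSheaf T.top (Type u))
  exact comp_preservesFiniteLimits _ _

/-! ### Restriction of sheaves and factorization through sheafification -/

section Continuity

variable {C D : Type u} [SmallCategory C] [SmallCategory D]
  {H : Profunctor.{u} C D} {J : GrothendieckTopology C} {K : GrothendieckTopology D}

theorem IsCoverFlat.isLocallyInjective_lext_map_sieve (hH : IsCoverFlat H K) {c : C} (S : Sieve c) :
    Presheaf.IsLocallyInjective K ((lext H).map S.functorInclusion) where
  equalizerSieve_mem {d} z z' hz := by
    induction z using LextObj.ind with
    | h c₁ x s =>
    induction z' using LextObj.ind with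
    | h c₂ x' s' =>
      refine K.superset_covering ?_ (hH.agreementSieve_mem hz)
      rintro d₁ v ⟨c₀, t, t', x₀, h, h', hs⟩
      change ((lext H).obj _).map v.op _ = ((lext H).obj _).map v.op _
      rw [LextObj.map_mk_eq _ _ _ _ h, LextObj.map_mk_eq _ _ _ _ h']
      exact congrArg (LextObj.mk x₀) (Subtype.ext hs)

theorem IsCoverDistributing.isLocallySurjective_lext_map_sieve (hH : IsCoverDistributing H J K)
    {c : C} {S : Sieve c} (hS : S ∈ J c) :
    Presheaf.IsLocallySurjective K ((lext H).map S.functorInclusion) where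
  imageSieve_mem {d} z := by
    induction z using LextObj.ind with
    | h c₁ x f =>
      refine K.superset_covering ?_ (hH c₁ d x _ (J.pullback_stable (show c₁ ⟶ c from f) hS))
      rintro d₁ v ⟨c₂, w, x', hw, h⟩
      refine ⟨LextObj.mk (H := H) (X := S.functor) x' ⟨_, hw⟩, ?_⟩
      rw [LextObj.map_mk_eq v w x x' h.symm]
      rfl

/-- The inclusion of a `J`-covering sieve is sent by `lext_H` to a `K`-local isomorphism, hence it
is orthogonal to `rest_H` of every `K`-sheaf. -/
theorem isSheaf_rest (hH : IsCoverDistributing H J K) (hH' : IsCoverFlat H K)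
    {Y : Dᵒᵖ ⥤ Type u} (hY : Presheaf.IsSheaf K Y) : Presheaf.IsSheaf J ((rest H).obj Y) := by
  rw [isSheaf_iff_isSheaf_of_type]
  intro c S hS
  rw [Presieve.isSheafFor_iff_yonedaSheafCondition]
  have := hH'.isLocallyInjective_lext_map_sieve S
  have := hH.isLocallySurjective_lext_map_sieve hS
  have hW : K.W ((lext H).map S.functorInclusion) := K.W_of_isLocallyBijective _
  exact Function.bijective_iff_existsUnique _ |>.1
    (((lextAdj H).map_comp_bijective_iff _ _).1 (hW Y hY))

theorem restrictionsPreserveSheaves : RestrictionsPreserveSheaves.{u} := fun _ _ _ hH _ hY =>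
  isSheaf_rest hH.coverDistributing hH.coverFlat hY

/-- Since `rest_H` preserves sheaves, its left adjoint `lext_H` preserves local isomorphisms. -/
theorem W_lext_map (hH : IsCoverDistributing H J K) (hH' : IsCoverFlat H K)
    {X Y : Cᵒᵖ ⥤ Type u} {f : X ⟶ Y} (hf : J.W f) : K.W ((lext H).map f) := fun _ hZ =>
  ((lextAdj H).map_comp_bijective_iff _ _).2 (hf _ (isSheaf_rest hH hH' hZ))

end Continuity

section Comparisons

variable {S T U : Site.{u}}

theorem isIso_shFactorization_app {H : Profunctor.{u} S.carrier T.carrier}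
    (hH : IsDistributorOfSites S T H) (X : S.carrierᵒᵖ ⥤ Type u) :
    IsIso ((shFactorization (S := S) (T := T) H).app X) :=
  (T.top.W_iff _).1 (W_lext_map hH.coverDistributing hH.coverFlat
    (S.top.W_adj_unit_app (sheafificationAdjunction S.top (Type u)) X))

theorem isIso_shFactorization {H : Profunctor.{u} S.carrier T.carrier}
    (hH : IsDistributorOfSites S T H) : IsIso (shFactorization (S := S) (T := T) H) := by
  have := isIso_shFactorization_app hH
  exact NatIso.isIso_of_isIso_app _

theorem isIso_shInverseImageComp (H : Profunctor.{u} S.carrier T.carrier)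
    {G : Profunctor.{u} T.carrier U.carrier} (hG : IsDistributorOfSites T U G) :
    IsIso (shInverseImageComp (S := S) (T := T) (U := U) H G) := by
  have : IsIso (Functor.whiskerRight (sheafificationAdjunction T.top (Type u)).unit
      (lext G ⋙ presheafToSheaf U.top (Type u))) := isIso_shFactorization hG
  exact (Functor.isoWhiskerLeft (sheafToPresheaf S.top (Type u))
    (Functor.isoWhiskerRight (lextComp H G) (presheafToSheaf U.top (Type u)) ≪≫
      Functor.isoWhiskerLeft (lext H) (asIso (Functor.whiskerRight
        (sheafificationAdjunction T.top (Type u)).unit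
        (lext G ⋙ presheafToSheaf U.top (Type u)))))).isIso_hom

theorem isIso_shInverseImageId (S : Site.{u}) : IsIso (shInverseImageId S) :=
  (Functor.isoWhiskerLeft (sheafToPresheaf S.top (Type u))
    (Functor.isoWhiskerRight (lextId S.carrier) (presheafToSheaf S.top (Type u))) ≪≫
    asIso (sheafificationAdjunction S.top (Type u)).counit).isIso_hom

end Comparisons

/-! ### Coherence of the comparison transformations -/

section Coherence

variable {S T U V : Site.{u}}

theorem shInverseImageComp_app (H : Profunctor.{u} S.carrier T.carrier)
    (G : Profunctor.{u} T.carrier U.carrier) (X : Sheaf S.top (Type u)) :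
    (shInverseImageComp (S := S) (T := T) (U := U) H G).app X =
      (presheafToSheaf U.top (Type u)).map ((lextComp H G).hom.app X.obj ≫
        (lext G).map ((sheafificationAdjunction T.top (Type u)).unit.app
          ((lext H).obj X.obj))) :=
  ((presheafToSheaf U.top (Type u)).map_comp _ _).symm

theorem sheafificationUnit_naturality_apply {P Q : S.carrierᵒᵖ ⥤ Type u} (f : P ⟶ Q)
    {c : S.carrierᵒᵖ} (s : P.obj c) :
    ((presheafToSheaf S.top (Type u)).map f).hom.app c
        (((sheafificationAdjunction S.top (Type u)).unit.app P).app c s) =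
      ((sheafificationAdjunction S.top (Type u)).unit.app Q).app c (f.app c s) :=
  (ConcreteCategory.congr_hom (NatTrans.congr_app
    ((sheafificationAdjunction S.top (Type u)).unit.naturality f) c) s).symm

theorem sheafificationCounit_unit_apply (X : Sheaf S.top (Type u)) {c : S.carrierᵒᵖ}
    (s : X.obj.obj c) :
    ((sheafificationAdjunction S.top (Type u)).counit.app X).hom.app c
      (((sheafificationAdjunction S.top (Type u)).unit.app X.obj).app c s) = s :=
  ConcreteCategory.congr_hom (NatTrans.congr_app
    ((sheafificationAdjunction S.top (Type u)).right_triangle_components X) c) s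

theorem shInverseImageComp_naturality_left {G G' : Profunctor.{u} T.carrier U.carrier}
    (η : G ⟶ G') (H : Profunctor.{u} S.carrier T.carrier) (X : Sheaf S.top (Type u)) :
    (shInverseImageMap (S := S) (T := U) (H := tensor G H) (H' := tensor G' H)
      (Functor.whiskerLeft H (lextMap η))).app X ≫
      (shInverseImageComp (S := S) (T := T) (U := U) H G').app X =
    (shInverseImageComp (S := S) (T := T) (U := U) H G).app X ≫
      (shInverseImageMap (S := T) (T := U) η).app
        ((shInverseImage (S := S) (T := T) H).obj X) := by
  rw [shInverseImageComp_app, shInverseImageComp_app]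
  refine ((presheafToSheaf U.top (Type u)).map_comp _ _).symm.trans
    (Eq.trans (congrArg _ ?_) ((presheafToSheaf U.top (Type u)).map_comp _ _))
  ext b z
  obtain ⟨c, ⟨d, y, x⟩, s⟩ := z
  rfl

theorem shInverseImageComp_naturality_right (G : Profunctor.{u} T.carrier U.carrier)
    {H H' : Profunctor.{u} S.carrier T.carrier} (η : H ⟶ H') (X : Sheaf S.top (Type u)) :
    (shInverseImageMap (S := S) (T := U) (H := tensor G H) (H' := tensor G H')
      (Functor.whiskerRight η (lext G))).app X ≫
      (shInverseImageComp (S := S) (T := T) (U := U) H' G).app X =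
    (shInverseImageComp (S := S) (T := T) (U := U) H G).app X ≫
      (shInverseImage (S := T) (T := U) G).map ((shInverseImageMap (S := S) (T := T) η).app X) := by
  rw [shInverseImageComp_app, shInverseImageComp_app]
  refine ((presheafToSheaf U.top (Type u)).map_comp _ _).symm.trans
    (Eq.trans (congrArg _ ?_) ((presheafToSheaf U.top (Type u)).map_comp _ _))
  ext b z
  obtain ⟨c, ⟨d, y, x⟩, s⟩ := z
  exact congrArg (LextObj.mk y) (sheafificationUnit_naturality_apply ((lextMap η).app X.obj)
    (LextObj.mk x s)).symm

/-- Both composites send `[[[l, y], x], s]` to `[l, [y, [x, s]]]` with the unit of sheafification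
applied to the inner two classes; on the left this uses that the unit is natural with respect to the
comparison map of `H` and `G`. -/
theorem shInverseImageComp_assoc (H : Profunctor.{u} S.carrier T.carrier)
    (G : Profunctor.{u} T.carrier U.carrier) (L : Profunctor.{u} U.carrier V.carrier)
    (X : Sheaf S.top (Type u)) :
    (shInverseImageMap (S := S) (T := V) (H := tensor (tensor L G) H) (H' := tensor L (tensor G H))
      (Functor.isoWhiskerLeft H (lextComp G L)).hom).app X ≫
      (shInverseImageComp (S := S) (T := U) (U := V) (tensor G H) L).app X ≫
        (shInverseImage (S := U) (T := V) L).map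
          ((shInverseImageComp (S := S) (T := T) (U := U) H G).app X) =
    (shInverseImageComp (S := S) (T := T) (U := V) H (tensor L G)).app X ≫
      (shInverseImageComp (S := T) (T := U) (U := V) G L).app
        ((shInverseImage (S := S) (T := T) H).obj X) := by
  rw [shInverseImageComp_app, shInverseImageComp_app, shInverseImageComp_app,
    shInverseImageComp_app]
  refine (congrArg (_ ≫ ·) ((presheafToSheaf V.top (Type u)).map_comp _ _).symm).trans
    (((presheafToSheaf V.top (Type u)).map_comp _ _).symm.trans
      (Eq.trans (congrArg _ ?_) ((presheafToSheaf V.top (Type u)).map_comp _ _)))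
  ext b z
  obtain ⟨c, ⟨d, ⟨e, l, y⟩, x⟩, s⟩ := z
  exact congrArg (LextObj.mk l) (sheafificationUnit_naturality_apply
    ((lextComp H G).hom.app X.obj ≫ (lext G).map
      ((sheafificationAdjunction T.top (Type u)).unit.app ((lext H).obj X.obj)))
    (LextObj.mk (LextObj.mk y x) s))

/-- Naturality of `lext_{hom} ≅ 𝟭` moves the unit of sheafification to the end of the composite,
where it cancels against the counit. -/
theorem shInverseImageMap_rightUnitor (H : Profunctor.{u} S.carrier T.carrier)
    (X : Sheaf S.top (Type u)) :
    (shInverseImageMap (S := S) (T := T) (H := tensor Profunctor.id H) (H' := H)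
      (Functor.isoWhiskerLeft H (lextId T.carrier) ≪≫ H.rightUnitor).hom).app X =
    (shInverseImageComp (S := S) (T := T) (U := T) H Profunctor.id).app X ≫
      (shInverseImageId T).app ((shInverseImage (S := S) (T := T) H).obj X) := by
  rw [shInverseImageComp_app]
  let Q := (lext H).obj X.obj
  let η := (sheafificationAdjunction T.top (Type u)).unit.app Q
  have key : ((lextComp H Profunctor.id).hom.app X.obj ≫ (lext Profunctor.id).map η) ≫
      (lextId T.carrier).hom.app _ = (lextMap (H := tensor Profunctor.id H) (H' := H)
        (Functor.isoWhiskerLeft H (lextId T.carrier) ≪≫ H.rightUnitor).hom).app X.obj ≫ η := by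
    ext b z
    obtain ⟨c, ⟨d, f, x⟩, s⟩ := z
    exact (NatTrans.naturality_apply η (Quiver.Hom.op f) (LextObj.mk x s)).symm
  have key' := ((presheafToSheaf T.top (Type u)).map_comp _ _).symm.trans
    ((congrArg (presheafToSheaf T.top (Type u)).map key).trans
      ((presheafToSheaf T.top (Type u)).map_comp _ _))
  refine Eq.trans ?_ (Category.assoc _ _ _)
  refine Eq.trans ?_ (congrArg (· ≫ _) key'.symm)
  refine Eq.trans ?_ (Category.assoc _ _ _).symm
  refine (Category.comp_id _).symm.trans (congrArg (_ ≫ ·) ?_)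
  exact ((sheafificationAdjunction T.top (Type u)).left_triangle_components Q).symm

theorem shInverseImageMap_leftUnitor (H : Profunctor.{u} S.carrier T.carrier)
    (X : Sheaf S.top (Type u)) :
    (shInverseImageMap (S := S) (T := T) (H := tensor H Profunctor.id) (H' := H)
      (tensorIdIso H).hom).app X =
    (shInverseImageComp (S := S) (T := S) (U := T) Profunctor.id H).app X ≫
      (shInverseImage (S := S) (T := T) H).map ((shInverseImageId S).app X) := by
  rw [shInverseImageComp_app]
  refine Eq.trans (congrArg _ ?_) ((presheafToSheaf T.top (Type u)).map_comp _ _)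
  ext b z
  obtain ⟨c, ⟨c', x, f⟩, s⟩ := z
  refine (LextObj.sound (show c' ⟶ c from f) x s).trans (congrArg (LextObj.mk x) ?_)
  refine Eq.trans ?_ (congrArg (((sheafificationAdjunction S.top (Type u)).counit.app X).hom.app _)
    (sheafificationUnit_naturality_apply ((lextId S.carrier).hom.app X.obj)
      (LextObj.mk (H := Profunctor.id) f s)).symm)
  exact (sheafificationCounit_unit_apply X _).symm

end Coherence

/-! ### The pseudofunctor -/

section Oplax

variable {hid : UnitClosed.{u}} {hcomp : TensorClosed.{u}} (hlex : InverseImagesLex.{u})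
  (hsh : RestrictionsPreserveSheaves.{u})

theorem isIso_geometricTransformation {E F : Topos.{u}} {f g : E ⟶ F} {φ : f ⟶ g}
    (h : IsIso (GeometricTransformation.trans φ)) : IsIso φ :=
  (GeometricMorphism.mkIso (asIso (GeometricTransformation.trans φ))).isIso_hom

/-- `Sh` as an oplax functor whose comparison cells are the canonical ones; the invertibility of
these cells is a separate statement. Composition in the source is that of the opposite bicategory,
so the two unitors, as well as left and right whiskering, are exchanged. -/
noncomputable def shOplax : OplaxFunctor (SiteDist hid hcomp)ᵒᵖ Topos.{u} where
  toPrelaxFunctor := shPrelax hid hcomp hlex hsh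
  mapId S := shUnitCell hlex hsh S
  mapComp G H := shTensorCell hlex hsh G H
  mapComp_naturality_left η H := GeometricMorphism.hom_ext fun X =>
    shInverseImageComp_naturality_left η.unop2.trans H.unop.dist X
  mapComp_naturality_right G _ _ η := GeometricMorphism.hom_ext fun X =>
    shInverseImageComp_naturality_right G.unop.dist η.unop2.trans X
  map₂_associator L G H := GeometricMorphism.hom_ext fun X =>
    (shInverseImageComp_assoc H.unop.dist G.unop.dist L.unop.dist X).trans
      (congrArg (_ ≫ ·) (Category.comp_id _).symm)
  map₂_leftUnitor H := GeometricMorphism.hom_ext fun X =>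
    (shInverseImageMap_rightUnitor H.unop.dist X).trans
      (congrArg (_ ≫ ·) (Category.comp_id _).symm)
  map₂_rightUnitor H := GeometricMorphism.hom_ext fun X =>
    (shInverseImageMap_leftUnitor H.unop.dist X).trans
      (congrArg (_ ≫ ·) (Category.comp_id _).symm)

end Oplax

end SiteDistributors

theorem mainTheorem4 :
    ∃ (hid : SiteDistributors.UnitClosed.{u}) (hcomp : SiteDistributors.TensorClosed.{u})
      (hlex : SiteDistributors.InverseImagesLex.{u})
      (hsh : SiteDistributors.RestrictionsPreserveSheaves.{u}),
      (∀ (S T : SiteDistributors.Site.{u}) (H : SiteDistributors.DistributorOfSites S T),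
        IsIso (SiteDistributors.shFactorization H.dist)) ∧
      ∃ F : Pseudofunctor (SiteDistributors.SiteDist hid hcomp)ᵒᵖ SiteDistributors.Topos.{u},
        F.toPrelaxFunctor = SiteDistributors.shPrelax hid hcomp hlex hsh ∧
        (∀ S : (SiteDistributors.SiteDist hid hcomp)ᵒᵖ,
          (F.mapId S).hom ≍ SiteDistributors.shUnitCell hlex hsh S) ∧
        ∀ {U T S : (SiteDistributors.SiteDist hid hcomp)ᵒᵖ} (G : U ⟶ T) (H : T ⟶ S),
          (F.mapComp G H).hom ≍ SiteDistributors.shTensorCell hlex hsh G H := by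
  refine ⟨SiteDistributors.unitClosed, SiteDistributors.tensorClosed,
    SiteDistributors.inverseImagesLex, SiteDistributors.restrictionsPreserveSheaves,
    fun S T H => SiteDistributors.isIso_shFactorization H.isDistributorOfSites, ?_⟩
  let F := SiteDistributors.shOplax (hid := SiteDistributors.unitClosed)
    (hcomp := SiteDistributors.tensorClosed) SiteDistributors.inverseImagesLex
    SiteDistributors.restrictionsPreserveSheaves
  have hId S : IsIso (F.mapId S) := SiteDistributors.isIso_geometricTransformation
    (SiteDistributors.isIso_shInverseImageId S.unop.site)
  have hComp {U T S : (SiteDistributors.SiteDist _ _)ᵒᵖ} (G : U ⟶ T) (H : T ⟶ S) :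
      IsIso (F.mapComp G H) :=
    SiteDistributors.isIso_geometricTransformation
      (SiteDistributors.isIso_shInverseImageComp H.unop.dist G.unop.isDistributorOfSites)
  exact ⟨.mkOfOplax' F, rfl, fun _ => .rfl, fun _ _ => .rfl⟩
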